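/- Let $n\ge 1$ and let $k$ be an even integer with $1\le k\le n-1$; let $\mu>k$. Let $f\in C^k(\mathbb R^n)$ be a (real- or complex-valued) function such that $\partial^\alpha f(x)=O(|x|^{-\mu})$ as $|x|\to\infty$ for every multi-index $\alpha$ with $|\alpha|\le k$. For a $k$-plane $\tau=\zeta+u$ in $\mathbb R^n$ ($\zeta$ a $k$-dimensional linear subspace, $u\in\zeta^\perp$) let $(Rf)(\tau)=\int_\zeta f(u+v)\,dv$ be the $k$-plane transform, and for a function $\varphi$ on the set of $k$-planes, $x\in\mathbb R^n$ and $r>0$ let $$(R^*_x\varphi)(r)=\int_{SO(n)}\varphi(\gamma\mathbb R^k+x+r\gamma e_n)\,d\gamma ,$$ where $\mathbb R^k=\mathbb R e_1\oplus\cdots\oplus\mathbb R e_k$ and $d\gamma$ is the Haar probability measure on $SO(n)$. Then, for $\varphi=Rf$, the integrals defining $(Rf)(\tau)$ (for every $k$-plane $\tau$) and $(R^*_x\varphi)(r)$ (for every $x\in\mathbb R^n$, $r>0$) converge absolutely, the function $r\mapsto (R^*_x\varphi)(r)$ is $k$ times continuously differentiable on $(0,\infty)$ for every $x$, and $$f(x)=\lim_{r\to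 0^+} c_k\,(-\partial_r)^k\,(R^*_x\varphi)(r),\qquad c_k=\frac{(-1)^{k/2}}{(k-1)!\,\sigma_{k-1}},\qquad \sigma_{k-1}=\frac{2\pi^{k/2}}{\Gamma(k/2)},$$ where the limit is uniform in $x\in\mathbb R^n$. -/

import Mathlib

open MeasureTheory Filter Topology

noncomputable section

namespace KPlane

/-- The Euclidean space `ℝⁿ`. -/
abbrev Euc (n : ℕ) : Type := EuclideanSpace ℝ (Fin n)

/-! ### The group `SO(n)` and its normalized Haar measure -/

/-- The rotation group `SO(n)`: real orthogonal `n × n` matrices of determinant one. -/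
abbrev SO (n : ℕ) : Type := ↥(Matrix.specialOrthogonalGroup (Fin n) ℝ)

instance instIsTopologicalGroupSO (n : ℕ) : IsTopologicalGroup (SO n) where
  continuous_inv := by
    refine Continuous.subtype_mk ?_ _
    exact (continuous_star (R := Matrix (Fin n) (Fin n) ℝ)).comp continuous_subtype_val

instance instCompactSpaceSO (n : ℕ) : CompactSpace (SO n) := by
  have hK : IsCompact (Set.univ.pi fun _ : Fin n => Set.univ.pi fun _ : Fin n =>
      Metric.closedBall (0 : ℝ) 1) :=
    isCompact_univ_pi fun _ => isCompact_univ_pi fun _ => isCompact_closedBall 0 1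
  have hc : IsClosed {A : Matrix (Fin n) (Fin n) ℝ | star A * A = 1 ∧ A.det = 1} :=
    (isClosed_eq ((continuous_star).mul continuous_id) continuous_const).inter
      (isClosed_eq continuous_id.matrix_det continuous_const)
  have hS : ((Matrix.specialOrthogonalGroup (Fin n) ℝ : Submonoid _) :
      Set (Matrix (Fin n) (Fin n) ℝ)) = {A | star A * A = 1 ∧ A.det = 1} := by
    ext A
    simp only [SetLike.mem_coe, Matrix.mem_specialOrthogonalGroup_iff,
      Matrix.mem_orthogonalGroup_iff', Set.mem_ofPred_eq]
    exact Iff.rfl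
  refine isCompact_iff_compactSpace.mp (IsCompact.of_isClosed_subset hK (hS ▸ hc) ?_)
  intro A hA i _ j _
  rw [mem_closedBall_zero_iff]
  exact entry_norm_bound_of_unitary (Matrix.mem_specialUnitaryGroup_iff.mp hA).1 i j

instance instMeasurableSpaceSO (n : ℕ) : MeasurableSpace (SO n) := borel _

instance instBorelSpaceSO (n : ℕ) : BorelSpace (SO n) := ⟨rfl⟩

/-- The Haar measure on `SO(n)` of total mass one. -/
def haarSO (n : ℕ) : Measure (SO n) := Measure.haarMeasure ⊤

theorem haarSO_univ (n : ℕ) : haarSO n Set.univ = 1 :=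
  Measure.haarMeasure_self (K₀ := (⊤ : TopologicalSpace.PositiveCompacts (SO n)))

/-- The rotation `y ↦ γ y` of `ℝⁿ` given by `γ ∈ SO(n)`. -/
def rot {n : ℕ} (γ : SO n) : Euc n →ₗ[ℝ] Euc n := Matrix.toEuclideanLin γ.1

theorem rot_injective {n : ℕ} (γ : SO n) : Function.Injective (rot γ) := by
  have h : ∀ y, rot γ⁻¹ (rot γ y) = y := by
    intro y
    have h1 : (γ⁻¹).1 * γ.1 = 1 := congrArg Subtype.val (inv_mul_cancel γ)
    ext i
    simp [rot, Matrix.toEuclideanLin, h1]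
  exact Function.LeftInverse.injective h

/-! ### Planes -/

/-- The coordinate subspace `ℝᵏ = ℝe₁ ⊕ ⋯ ⊕ ℝe_k` of `ℝⁿ`. -/
def coordSubspace (n k : ℕ) : Submodule ℝ (Euc n) :=
  Submodule.span ℝ
    (Set.range fun i : {i : Fin n // (i : ℕ) < k} => EuclideanSpace.single i.1 (1 : ℝ))

theorem finrank_coordSubspace {n k : ℕ} (hk : k ≤ n) :
    Module.finrank ℝ (coordSubspace n k) = k := by
  have hli : LinearIndependent ℝ
      (fun i : {i : Fin n // (i : ℕ) < k} => EuclideanSpace.single i.1 (1 : ℝ)) := by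
    have h := (EuclideanSpace.basisFun (Fin n) ℝ).orthonormal.linearIndependent.comp
      (fun i : {i : Fin n // (i : ℕ) < k} => i.1) Subtype.val_injective
    have he : (⇑(EuclideanSpace.basisFun (Fin n) ℝ) ∘ fun i : {i : Fin n // (i : ℕ) < k} => i.1) =
        fun i : {i : Fin n // (i : ℕ) < k} => EuclideanSpace.single i.1 (1 : ℝ) := by
      ext i j
      simp
    rwa [he] at h
  rw [coordSubspace, finrank_span_eq_card hli, Fintype.card_subtype, Fin.card_filter_val_lt]
  omega

/-- The coordinate unit vector `e_n` of `ℝⁿ` (the zero vector if `n = 0`). -/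
def lastVec (n : ℕ) : Euc n := WithLp.toLp 2 fun i => if (i : ℕ) + 1 = n then 1 else 0

/-- The manifold of all (non-oriented, affine) `k`-planes in `ℝⁿ`. -/
def AffinePlane (n k : ℕ) : Type :=
  {τ : AffineSubspace ℝ (Euc n) // (τ : Set (Euc n)).Nonempty ∧ Module.finrank ℝ τ.direction = k}

/-- The point `u ∈ ζ^⊥` with `τ = ζ + u`, where `ζ` is the direction of `τ`; it is the point of
`τ` closest to the origin. -/
def AffinePlane.foot {n k : ℕ} (τ : AffinePlane n k) : Euc n :=
  haveI : Nonempty τ.1 := τ.2.1.to_subtype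
  (EuclideanGeometry.orthogonalProjection τ.1 (0 : Euc n) : Euc n)

theorem AffinePlane.foot_mem {n k : ℕ} (τ : AffinePlane n k) : τ.foot ∈ τ.1 := by
  have : Nonempty τ.1 := τ.2.1.to_subtype
  exact EuclideanGeometry.orthogonalProjection_mem (0 : Euc n)

theorem AffinePlane.foot_mem_orthogonal {n k : ℕ} (τ : AffinePlane n k) :
    τ.foot ∈ τ.1.directionᗮ := by
  have : Nonempty τ.1 := τ.2.1.to_subtype
  have h := EuclideanGeometry.orthogonalProjection_vsub_mem_direction_orthogonal τ.1 (0 : Euc n)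
  simpa [foot] using h

/-- The `k`-plane `γℝᵏ + a`, for `γ ∈ SO(n)` and `a ∈ ℝⁿ`. -/
def rotatedPlane {n k : ℕ} (hk : k ≤ n) (γ : SO n) (a : Euc n) : AffinePlane n k :=
  ⟨AffineSubspace.mk' a ((coordSubspace n k).map (rot γ)),
    ⟨a, AffineSubspace.self_mem_mk' _ _⟩, by
      rw [AffineSubspace.direction_mk']
      refine Eq.trans ?_ (finrank_coordSubspace hk)
      exact (Submodule.equivMapOfInjective (rot γ) (rot_injective γ)
        (coordSubspace n k)).finrank_eq.symm⟩

/-! ### The transforms -/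

/-- The `k`-plane transform `(Rf)(τ) = (Rf)(ζ, u) = ∫_ζ f(u + v) dv`, `dv` being the Lebesgue
measure of the Euclidean space `ζ`. -/
def radon {𝕜 : Type*} [RCLike 𝕜] {n : ℕ} (k : ℕ) (f : Euc n → 𝕜) (τ : AffinePlane n k) : 𝕜 :=
  ∫ v : τ.1.direction, f (τ.foot + (v : Euc n))

/-- The shifted dual transform `(R*_x φ)(r) = ∫_{SO(n)} φ(γℝᵏ + x + rγe_n) dγ`. -/
def shiftedDual {𝕜 : Type*} [RCLike 𝕜] {n k : ℕ} (hk : k ≤ n)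
    (φ : AffinePlane n k → 𝕜) (x : Euc n) (r : ℝ) : 𝕜 :=
  ∫ γ : SO n, φ (rotatedPlane hk γ (x + r • rot γ (lastVec n))) ∂(haarSO n)

/-- The class `C^k_μ(ℝⁿ)`: functions `f ∈ C^k(ℝⁿ)` whose partial derivatives
`∂_{a₁} ⋯ ∂_{aₘ} f` of every order `m ≤ k` are `O(|x|^{-μ})` as `|x| → ∞`. -/
def DecayClass {𝕜 : Type*} [RCLike 𝕜] (n k : ℕ) (μ : ℝ) (f : Euc n → 𝕜) : Prop :=
  ContDiff ℝ k f ∧ ∀ m ≤ k, ∀ a : Fin m → Fin n,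
    (fun x => iteratedFDeriv ℝ m f x fun i => EuclideanSpace.single (a i) (1 : ℝ))
      =O[Bornology.cobounded (Euc n)] fun x => ‖x‖ ^ (-μ)

/-- The area `σ_m = 2π^{(m+1)/2} / Γ((m+1)/2)` of the unit sphere `S^m` in `ℝ^{m+1}`. -/
def sphereArea (m : ℕ) : ℝ :=
  2 * Real.pi ^ (((m : ℝ) + 1) / 2) / Real.Gamma (((m : ℝ) + 1) / 2)

/-- The constant `c_k = (-1)^{k/2} / ((k-1)! σ_{k-1})`, for even `k ≥ 2`. -/
def inversionConst (k : ℕ) : ℝ :=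
  (-1) ^ (k / 2) / ((k - 1).factorial * sphereArea (k - 1))

end KPlane

end

/-!
Write `k = 2(m + 1)` and let `M(s)` be the mean of `f` over the sphere of centre `x` and radius `s`.
Parametrizing the plane `γℝᵏ + x + rγe_n` by `ℝᵏ` and averaging over `γ` first
(`shiftedDual_radon_eq_integral_sphericalMean`) gives
`(R*_x Rf)(r) = ∫_{ℝᵏ} M(√(|v|² + r²)) dv`, because `SO(n)` is transitive on spheres. Polar
coordinates and the substitution `s = √(|v|² + r²)` turn this into
`σ_{k-1} ∫_r^∞ s (s² - r²)^m M(s) ds`.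

The decisive remark is that `k` even makes the kernel a polynomial in `r`. Hence
`∫_r^∞ = ∫₀^∞ - ∫₀^r`, where the integral over `(0, ∞)` is a polynomial in `r` of degree `k - 2`, and
the integral over `(0, r)` equals `r^k P(r)` with `P(r) = ∫₀¹ t (t² - 1)^m M(rt) dt`
(`shiftedDual_radon_eq`). The function `P` is an average of `f(x + rtγe_n)` over `(t, γ)`, so it is
as smooth in `r` as `f` is, with derivatives bounded uniformly in `x`
(`contDiff_radialIntegral`, `norm_radialIntegral_le`).

The `k`-th derivative kills the polynomial, and by the Leibniz rule that of `r^k P(r)` is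
`k! P(0) + O(r)`, uniformly in `x` (`norm_iteratedDeriv_pow_smul_sub_le`). Finally
`P(0) = f(x) ∫₀¹ t (t² - 1)^m dt = (-1)^m f(x) / k`, and `c_k` is the matching constant.
-/

noncomputable section

namespace KPlane

variable {𝕜 : Type*} [RCLike 𝕜]

/-! ### Global bounds from decay at infinity -/

/-- A continuous function that is `O(|x|^{-μ})` at infinity obeys a bound on the whole space once
`|x|` is replaced by `1 + |x|`: the product `(1 + |x|)^μ |g x|` is continuous and eventually
bounded. -/
theorem exists_norm_le_one_add_norm_rpow {E F : Type*} [NormedAddCommGroup E] [ProperSpace E]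
    [NormedAddCommGroup F] {μ : ℝ} (hμ : 0 ≤ μ) {g : E → F} (hg : Continuous g)
    (hO : g =O[Bornology.cobounded E] fun x => ‖x‖ ^ (-μ)) :
    ∃ C, 0 ≤ C ∧ ∀ x, ‖g x‖ ≤ C * (1 + ‖x‖) ^ (-μ) := by
  obtain ⟨c, hc⟩ := hO.bound
  obtain ⟨R, -, hR⟩ := (hasBasis_cobounded_norm (E := E)).mem_iff.1 hc
  have hcont : Continuous fun x : E => (1 + ‖x‖) ^ μ * ‖g x‖ := by
    refine Continuous.mul ?_ hg.norm
    exact (continuous_const.add continuous_norm).rpow_const fun x => Or.inr hμ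
  obtain ⟨B, hB⟩ := (isCompact_closedBall (0 : E) (max R 1)).bddAbove_image hcont.continuousOn
  have key : ∀ x, (1 + ‖x‖) ^ μ * ‖g x‖ ≤ max (max B (2 ^ μ * c)) 0 := by
    intro x
    by_cases hx : ‖x‖ ≤ max R 1
    · refine le_max_of_le_left (le_max_of_le_left (hB ⟨x, ?_, rfl⟩))
      simpa using hx
    · push Not at hx
      have h1 : 1 < ‖x‖ := (le_max_right _ _).trans_lt hx
      have h2 : ‖g x‖ ≤ c * ‖‖x‖ ^ (-μ)‖ := hR (le_of_lt ((le_max_left R 1).trans_lt hx))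
      have h0 : 0 < ‖x‖ := one_pos.trans h1
      rw [Real.norm_of_nonneg (Real.rpow_nonneg h0.le _), Real.rpow_neg h0.le] at h2
      have hp : 0 < ‖x‖ ^ μ := Real.rpow_pos_of_pos h0 μ
      have h3 : (1 + ‖x‖) ^ μ ≤ 2 ^ μ * ‖x‖ ^ μ := by
        rw [← Real.mul_rpow (by norm_num) h0.le]
        exact Real.rpow_le_rpow (by positivity) (by linarith) hμ
      refine le_max_of_le_left (le_max_of_le_right ?_)
      calc (1 + ‖x‖) ^ μ * ‖g x‖ ≤ (2 ^ μ * ‖x‖ ^ μ) * (c * (‖x‖ ^ μ)⁻¹) := by gcongr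
        _ = 2 ^ μ * c := by field_simp
  refine ⟨max (max B (2 ^ μ * c)) 0, le_max_right _ _, fun x => ?_⟩
  have hp : 0 < (1 + ‖x‖) ^ μ := Real.rpow_pos_of_pos (by positivity) μ
  rw [Real.rpow_neg (by positivity), ← div_eq_mul_inv, le_div_iff₀ hp, mul_comm]
  exact key x

theorem DecayClass.exists_norm_le {n k : ℕ} {μ : ℝ} (hμ : 0 ≤ μ) {f : Euc n → 𝕜}
    (hf : DecayClass n k μ f) : ∃ C, 0 ≤ C ∧ ∀ x, ‖f x‖ ≤ C * (1 + ‖x‖) ^ (-μ) := by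
  refine exists_norm_le_one_add_norm_rpow hμ hf.1.continuous ?_
  simpa using hf.2 0 (Nat.zero_le _) Fin.elim0

/-- The derivatives of order at most `k` of a function of the decay class are bounded on the whole
space. Only the diagonal values `D^m f(y)(v, …, v)`, the directional derivatives, are needed; they
are combinations of the partial derivatives with coefficients `∏ v_{a i}`. -/
theorem DecayClass.exists_norm_iteratedFDeriv_le {n k : ℕ} {μ : ℝ} (hμ : 0 ≤ μ) {f : Euc n → 𝕜}
    (hf : DecayClass n k μ f) {m : ℕ} (hm : m ≤ k) :
    ∃ B, ∀ y v, ‖v‖ ≤ 1 → ‖iteratedFDeriv ℝ m f y (fun _ => v)‖ ≤ B := by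
  have hcont : Continuous (iteratedFDeriv ℝ m f) :=
    hf.1.continuous_iteratedFDeriv (by exact_mod_cast hm)
  have h : ∀ a : Fin m → Fin n, ∃ C, ∀ y,
      ‖iteratedFDeriv ℝ m f y fun i => EuclideanSpace.single (a i) (1 : ℝ)‖ ≤ C := by
    intro a
    obtain ⟨C, hC0, hC⟩ := exists_norm_le_one_add_norm_rpow hμ
      (hcont.eval_const fun i => EuclideanSpace.single (a i) (1 : ℝ)) (hf.2 m hm a)
    refine ⟨C, fun y => (hC y).trans (mul_le_of_le_one_right hC0 ?_)⟩
    exact Real.rpow_le_one_of_one_le_of_nonpos (by simp) (by simpa)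
  choose C hC using h
  refine ⟨∑ a, C a, fun y v hv => ?_⟩
  have hexp : v = ∑ j, v j • EuclideanSpace.single j (1 : ℝ) := by
    conv_lhs => rw [← (EuclideanSpace.basisFun (Fin n) ℝ).sum_repr v]
    simp
  have hsum : iteratedFDeriv ℝ m f y (fun _ => v) = ∑ a : Fin m → Fin n, (∏ i, v (a i)) •
      iteratedFDeriv ℝ m f y fun i => EuclideanSpace.single (a i) (1 : ℝ) := by
    conv_lhs => rw [hexp]
    rw [ContinuousMultilinearMap.map_sum]
    refine Finset.sum_congr rfl fun a _ => ?_
    rw [ContinuousMultilinearMap.map_smul_univ]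
  rw [hsum]
  refine (norm_sum_le _ _).trans (Finset.sum_le_sum fun a _ => ?_)
  rw [norm_smul, norm_prod]
  refine le_trans (mul_le_of_le_one_left (norm_nonneg _) ?_) (hC a y)
  exact Finset.prod_le_one (fun _ _ => norm_nonneg _)
    fun i _ => (PiLp.norm_apply_le v (a i)).trans hv

/-! ### Derivatives of weighted radial integrals -/

/-- The weighted average `∫ w(ω) D^m f(x + r v(ω))(v(ω), …, v(ω)) dν(ω)` of the `m`-th directional
derivatives along the segments `r ↦ x + r v(ω)`. For `m = 0` it is a weighted average of `f`, and
its `m`-th derivative in `r` is the one with index `m`. -/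
def radialIntegral {n : ℕ} {Ω : Type*} [MeasurableSpace Ω] (ν : Measure Ω) (w : Ω → ℝ)
    (v : Ω → Euc n) (f : Euc n → 𝕜) (m : ℕ) (x : Euc n) (r : ℝ) : 𝕜 :=
  ∫ ω, w ω • iteratedFDeriv ℝ m f (x + r • v ω) (fun _ => v ω) ∂ν

section
variable {n k : ℕ} {Ω : Type*} {w : Ω → ℝ} {v : Ω → Euc n} {f : Euc n → 𝕜}

theorem continuous_radialIntegrand [TopologicalSpace Ω] (hf : ContDiff ℝ k f)
    (hw : Continuous w) (hv : Continuous v)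
    {m : ℕ} (hm : m ≤ k) (x : Euc n) (r : ℝ) :
    Continuous fun ω => w ω • iteratedFDeriv ℝ m f (x + r • v ω) (fun _ => v ω) := by
  have hcont : Continuous (iteratedFDeriv ℝ m f) :=
    hf.continuous_iteratedFDeriv (by exact_mod_cast hm)
  refine hw.smul ((hcont.comp (by fun_prop)).eval (by fun_prop))

variable [MeasurableSpace Ω] {ν : Measure Ω}

theorem norm_radialIntegrand_le {m : ℕ} {B : ℝ}
    (hB : ∀ y u, ‖u‖ ≤ 1 → ‖iteratedFDeriv ℝ m f y (fun _ => u)‖ ≤ B)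
    (hw1 : ∀ᵐ ω ∂ν, |w ω| ≤ 1) (hv1 : ∀ᵐ ω ∂ν, ‖v ω‖ ≤ 1) (x : Euc n) :
    ∀ᵐ ω ∂ν, ∀ r : ℝ, ‖w ω • iteratedFDeriv ℝ m f (x + r • v ω) (fun _ => v ω)‖ ≤ B := by
  filter_upwards [hw1, hv1] with ω h1 h2 r
  rw [norm_smul, Real.norm_eq_abs]
  exact (mul_le_of_le_one_left (norm_nonneg _) h1).trans (hB _ _ h2)

theorem norm_radialIntegral_le [IsFiniteMeasure ν] {m : ℕ} {B : ℝ}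
    (hB : ∀ y u, ‖u‖ ≤ 1 → ‖iteratedFDeriv ℝ m f y (fun _ => u)‖ ≤ B)
    (hw1 : ∀ᵐ ω ∂ν, |w ω| ≤ 1) (hv1 : ∀ᵐ ω ∂ν, ‖v ω‖ ≤ 1) (x : Euc n) (r : ℝ) :
    ‖radialIntegral ν w v f m x r‖ ≤ B * ν.real Set.univ :=
  norm_integral_le_of_norm_le_const
    ((norm_radialIntegrand_le hB hw1 hv1 x).mono fun _ h => h r)

variable [TopologicalSpace Ω] [OpensMeasurableSpace Ω] [IsFiniteMeasure ν]

theorem integrable_radialIntegrand (hf : ContDiff ℝ k f) (hw : Continuous w) (hv : Continuous v)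
    {m : ℕ} (hm : m ≤ k) {B : ℝ}
    (hB : ∀ y u, ‖u‖ ≤ 1 → ‖iteratedFDeriv ℝ m f y (fun _ => u)‖ ≤ B)
    (hw1 : ∀ᵐ ω ∂ν, |w ω| ≤ 1) (hv1 : ∀ᵐ ω ∂ν, ‖v ω‖ ≤ 1) (x : Euc n) (r : ℝ) :
    Integrable (fun ω => w ω • iteratedFDeriv ℝ m f (x + r • v ω) (fun _ => v ω)) ν :=
  Integrable.of_bound (continuous_radialIntegrand hf hw hv hm x r).aestronglyMeasurable B
    ((norm_radialIntegrand_le hB hw1 hv1 x).mono fun _ h => h r)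

theorem hasDerivAt_radialIntegral (hf : ContDiff ℝ k f) (hw : Continuous w) (hv : Continuous v)
    (hB : ∀ m ≤ k, ∃ B, ∀ y u, ‖u‖ ≤ 1 → ‖iteratedFDeriv ℝ m f y (fun _ => u)‖ ≤ B)
    (hw1 : ∀ᵐ ω ∂ν, |w ω| ≤ 1) (hv1 : ∀ᵐ ω ∂ν, ‖v ω‖ ≤ 1) {m : ℕ} (hm : m < k)
    (x : Euc n) (r : ℝ) :
    HasDerivAt (radialIntegral ν w v f m x) (radialIntegral ν w v f (m + 1) x r) r := by
  obtain ⟨B, hBm⟩ := hB m hm.le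
  obtain ⟨B', hBm'⟩ := hB (m + 1) hm
  refine (hasDerivAt_integral_of_dominated_loc_of_deriv_le (s := Set.univ) univ_mem
    (F := fun r ω => w ω • iteratedFDeriv ℝ m f (x + r • v ω) (fun _ => v ω))
    (F' := fun r ω => w ω • iteratedFDeriv ℝ (m + 1) f (x + r • v ω) (fun _ => v ω))
    (bound := fun _ => B')
    (.of_forall fun r => (continuous_radialIntegrand hf hw hv hm.le x r).aestronglyMeasurable)
    (integrable_radialIntegrand hf hw hv hm.le hBm hw1 hv1 x r)
    (continuous_radialIntegrand hf hw hv hm x r).aestronglyMeasurable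
    ((norm_radialIntegrand_le hBm' hw1 hv1 x).mono fun _ h r _ => h r)
    (integrable_const _) (.of_forall fun ω r _ => ?_)).2
  have h1 : HasFDerivAt (iteratedFDeriv ℝ m f) (fderiv ℝ (iteratedFDeriv ℝ m f) (x + r • v ω))
      (x + r • v ω) :=
    (hf.differentiable_iteratedFDeriv (by exact_mod_cast hm) _).hasFDerivAt
  have h2 : HasDerivAt (fun r : ℝ => x + r • v ω) (v ω) r := by
    simpa using ((hasDerivAt_id r).smul_const (v ω)).const_add x
  have h3 := h1.comp_hasDerivAt r h2
  have h4 := ((ContinuousMultilinearMap.apply ℝ (fun _ : Fin m => Euc n) 𝕜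
    (fun _ => v ω)).hasFDerivAt.comp_hasDerivAt r h3).fun_const_smul (w ω)
  simpa [iteratedFDeriv_succ_apply_left, Fin.tail_def, Function.comp_def] using h4

theorem iteratedDeriv_radialIntegral (hf : ContDiff ℝ k f) (hw : Continuous w) (hv : Continuous v)
    (hB : ∀ m ≤ k, ∃ B, ∀ y u, ‖u‖ ≤ 1 → ‖iteratedFDeriv ℝ m f y (fun _ => u)‖ ≤ B)
    (hw1 : ∀ᵐ ω ∂ν, |w ω| ≤ 1) (hv1 : ∀ᵐ ω ∂ν, ‖v ω‖ ≤ 1) {m : ℕ} (hm : m ≤ k)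
    (x : Euc n) :
    iteratedDeriv m (radialIntegral ν w v f 0 x) = radialIntegral ν w v f m x := by
  induction m with
  | zero => exact iteratedDeriv_zero
  | succ m ih =>
    rw [iteratedDeriv_succ, ih (Nat.le_of_succ_le hm)]
    exact funext fun r => (hasDerivAt_radialIntegral hf hw hv hB hw1 hv1 hm x r).deriv

theorem contDiff_radialIntegral (hf : ContDiff ℝ k f) (hw : Continuous w) (hv : Continuous v)
    (hB : ∀ m ≤ k, ∃ B, ∀ y u, ‖u‖ ≤ 1 → ‖iteratedFDeriv ℝ m f y (fun _ => u)‖ ≤ B)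
    (hw1 : ∀ᵐ ω ∂ν, |w ω| ≤ 1) (hv1 : ∀ᵐ ω ∂ν, ‖v ω‖ ≤ 1) (x : Euc n) :
    ContDiff ℝ k (radialIntegral ν w v f 0 x) := by
  refine contDiff_nat_iff_iteratedDeriv.2 ⟨fun m hm => ?_, fun m hm => ?_⟩
  · rw [iteratedDeriv_radialIntegral hf hw hv hB hw1 hv1 hm]
    obtain ⟨B, hBm⟩ := hB m hm
    refine continuous_of_dominated (bound := fun _ => B)
      (fun r => (continuous_radialIntegrand hf hw hv hm x r).aestronglyMeasurable)
      (fun r => (norm_radialIntegrand_le hBm hw1 hv1 x).mono fun _ h => h r)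
      (integrable_const _) (.of_forall fun ω => ?_)
    have hcont : Continuous (iteratedFDeriv ℝ m f) :=
      hf.continuous_iteratedFDeriv (by exact_mod_cast hm)
    exact ((hcont.comp (by fun_prop)).eval_const _).const_smul _
  · rw [iteratedDeriv_radialIntegral hf hw hv hB hw1 hv1 hm.le]
    exact fun r => (hasDerivAt_radialIntegral hf hw hv hB hw1 hv1 hm x r).differentiableAt

end

/-! ### Rotations -/

instance instIsProbabilityMeasureHaarSO (n : ℕ) : IsProbabilityMeasure (haarSO n) :=
  ⟨haarSO_univ n⟩

instance instIsHaarMeasureHaarSO (n : ℕ) : (haarSO n).IsHaarMeasure := by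
  unfold haarSO
  infer_instance

instance instIsMulRightInvariantHaarSO (n : ℕ) : (haarSO n).IsMulRightInvariant where
  map_mul_right_eq_self g := by
    have : IsProbabilityMeasure (Measure.map (· * g) (haarSO n)) :=
      Measure.isProbabilityMeasure_map (measurable_mul_const g).aemeasurable
    exact Measure.isHaarMeasure_eq_of_isProbabilityMeasure _ _

theorem norm_rot {n : ℕ} (γ : SO n) (y : Euc n) : ‖rot γ y‖ = ‖y‖ :=
  ContinuousLinearMap.norm_map_of_mem_unitary
    (Unitary.map_mem (Matrix.toEuclideanCLM (n := Fin n) (𝕜 := ℝ))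
      (Matrix.mem_specialUnitaryGroup_iff.mp γ.2).1) y

theorem rot_mul {n : ℕ} (γ g : SO n) (y : Euc n) : rot (γ * g) y = rot γ (rot g y) := by
  simp [rot, Matrix.toEuclideanLin]

theorem continuous_rot_apply {n : ℕ} : Continuous fun p : SO n × Euc n => rot p.1 p.2 := by
  have h : Continuous fun p : SO n × Euc n => p.1.1.mulVec p.2.ofLp :=
    (continuous_subtype_val.comp continuous_fst).matrix_mulVec
      ((PiLp.continuous_ofLp 2 _).comp continuous_snd)
  exact (PiLp.continuous_toLp 2 _).comp h

/-- A linear isometry of determinant one is given by an element of `SO(n)`. -/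
theorem exists_rot_eq {n : ℕ} {A : Euc n ≃ₗᵢ[ℝ] Euc n}
    (hA : LinearMap.det (A.toLinearEquiv : Euc n →ₗ[ℝ] Euc n) = 1) :
    ∃ g : SO n, ∀ y, rot g y = A y := by
  let b := EuclideanSpace.basisFun (Fin n) ℝ
  refine ⟨⟨LinearMap.toMatrix b.toBasis b.toBasis A.toLinearEquiv,
    Matrix.mem_specialUnitaryGroup_iff.mpr ⟨A.toMatrix_mem_unitaryGroup b b, ?_⟩⟩, fun y => ?_⟩
  · rw [LinearMap.det_toMatrix, hA]
  · have h := Matrix.toEuclideanLin_eq_toLin_orthonormal (𝕜 := ℝ) (m := Fin n) (n := Fin n)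
    rw [rot, h, Matrix.toLin_toMatrix]
    rfl

theorem det_reflection_orthogonal_span {n : ℕ} {u : Euc n} (hu : u ≠ 0) :
    LinearMap.det ((ℝ ∙ u)ᗮ.reflection.toLinearEquiv : Euc n →ₗ[ℝ] Euc n) = -1 := by
  rw [Submodule.det_reflection, Submodule.orthogonal_orthogonal, finrank_span_singleton hu, pow_one]

theorem lastVec_eq_single {n : ℕ} (hn : 1 ≤ n) :
    lastVec n = EuclideanSpace.single ⟨n - 1, by omega⟩ (1 : ℝ) := by
  ext i
  simp only [lastVec, PiLp.single_apply, Fin.ext_iff]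
  congr 1
  apply propext
  omega

theorem norm_lastVec {n : ℕ} (hn : 1 ≤ n) : ‖lastVec n‖ = 1 := by
  simp [lastVec_eq_single hn]

/-- `SO(n)` acts transitively on spheres when `n ≥ 2`. The reflection exchanging the two points has
determinant `-1`; it is corrected by the reflection in the first coordinate hyperplane, which
contains `e_n`. -/
theorem exists_rot_smul_lastVec {n : ℕ} (hn : 2 ≤ n) (y : Euc n) :
    ∃ g : SO n, rot g (‖y‖ • lastVec n) = y := by
  set u := ‖y‖ • lastVec n with hu
  have hnorm : ‖u‖ = ‖y‖ := by simp [hu, norm_smul, norm_lastVec (one_le_two.trans hn)]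
  rcases eq_or_ne u y with h | h
  · exact ⟨1, by simp [rot, h]⟩
  · let e₀ : Euc n := EuclideanSpace.single ⟨0, by omega⟩ (1 : ℝ)
    have he₀ : e₀ ≠ 0 := by simp [e₀]
    let R := (ℝ ∙ e₀)ᗮ.reflection
    let S := (ℝ ∙ (u - y))ᗮ.reflection
    obtain ⟨g, hg⟩ := exists_rot_eq (A := R.trans S) <| by
      have : ((R.trans S).toLinearEquiv : Euc n →ₗ[ℝ] Euc n) =
        (S.toLinearEquiv : Euc n →ₗ[ℝ] Euc n) ∘ₗ (R.toLinearEquiv : Euc n →ₗ[ℝ] Euc n) := rfl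
      rw [this, LinearMap.det_comp, det_reflection_orthogonal_span he₀,
        det_reflection_orthogonal_span (sub_ne_zero.2 h)]
      norm_num
    refine ⟨g, ?_⟩
    rw [hg]
    have hR : R u = u := by
      refine Submodule.reflection_mem_subspace_eq_self ?_
      rw [Submodule.mem_orthogonal_singleton_iff_inner_right, hu, inner_smul_right,
        lastVec_eq_single (one_le_two.trans hn)]
      simp [e₀, EuclideanSpace.inner_single_left, Fin.ext_iff]
      omega
    change S (R u) = y
    rw [hR]
    exact Submodule.reflection_sub hnorm

/-- The mean of `f` over the sphere of centre `x` and radius `s`, written as an average over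
rotations of the point `s e_n`. -/
def sphericalMean {n : ℕ} (f : Euc n → 𝕜) (x : Euc n) (s : ℝ) : 𝕜 :=
  ∫ γ : SO n, f (x + s • rot γ (lastVec n)) ∂(haarSO n)

/-- Averaging over all rotations depends on `y` only through `|y|`: write `y = |y| g e_n` and use
the right invariance of Haar measure. -/
theorem integral_rot_eq_sphericalMean {n : ℕ} (hn : 2 ≤ n) (f : Euc n → 𝕜) (x y : Euc n) :
    ∫ γ : SO n, f (x + rot γ y) ∂(haarSO n) = sphericalMean f x ‖y‖ := by
  obtain ⟨g, hg⟩ := exists_rot_smul_lastVec hn y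
  have h := integral_mul_right_eq_self (μ := haarSO n)
    (fun γ : SO n => f (x + rot γ (‖y‖ • lastVec n))) g
  simp only [rot_mul, hg] at h
  simpa only [map_smul, sphericalMean] using h

/-! ### Parametrization of the rotated planes -/

/-- The isometric embedding of `ℝᵏ` into `ℝⁿ` that sends `eᵢ` to `eᵢ`; its range is the coordinate
subspace. -/
def coordInclusion {n k : ℕ} (hk : k ≤ n) : Euc k →ₗᵢ[ℝ] Euc n :=
  LinearMap.isometryOfOrthonormal
    ((EuclideanSpace.basisFun (Fin k) ℝ).toBasis.constr ℝ
      fun i => EuclideanSpace.single (Fin.castLE hk i) (1 : ℝ))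
    (v := (EuclideanSpace.basisFun (Fin k) ℝ).toBasis)
    (by simp)
    (by
      have h := (EuclideanSpace.basisFun (Fin n) ℝ).orthonormal.comp _ (Fin.castLE_injective hk)
      have he : ⇑(EuclideanSpace.basisFun (Fin n) ℝ) ∘ Fin.castLE hk =
          fun i => EuclideanSpace.single (Fin.castLE hk i) (1 : ℝ) := by
        ext1 i
        simp
      rw [he] at h
      have hc : ⇑((EuclideanSpace.basisFun (Fin k) ℝ).toBasis.constr ℝ
          fun i => EuclideanSpace.single (Fin.castLE hk i) (1 : ℝ)) ∘
          ⇑(EuclideanSpace.basisFun (Fin k) ℝ).toBasis =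
          fun i => EuclideanSpace.single (Fin.castLE hk i) (1 : ℝ) :=
        funext fun i => Module.Basis.constr_basis _ _ _ i
      rwa [hc])

theorem range_coordInclusion {n k : ℕ} (hk : k ≤ n) :
    LinearMap.range (coordInclusion hk).toLinearMap = coordSubspace n k := by
  change LinearMap.range ((EuclideanSpace.basisFun (Fin k) ℝ).toBasis.constr ℝ _) = _
  rw [Module.Basis.constr_range, coordSubspace]
  congr 1
  ext z
  constructor
  · rintro ⟨i, rfl⟩
    exact ⟨⟨Fin.castLE hk i, i.2⟩, rfl⟩
  · rintro ⟨i, rfl⟩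
    exact ⟨⟨i.1, i.2⟩, rfl⟩

theorem inner_coordInclusion_lastVec {n k : ℕ} (hk : k ≤ n) (hkn : k ≤ n - 1) (hn : 1 ≤ n)
    (w : Euc k) : inner ℝ (coordInclusion hk w) (lastVec n) = 0 := by
  have hw : coordInclusion hk w ∈ coordSubspace n k := by
    rw [← range_coordInclusion hk]
    exact ⟨w, rfl⟩
  generalize coordInclusion hk w = z at hw
  induction hw using Submodule.span_induction with
  | mem z hz =>
    obtain ⟨i, rfl⟩ := hz
    have := i.2
    simp only [lastVec_eq_single hn, EuclideanSpace.inner_single_left, PiLp.single_apply,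
      Fin.ext_iff]
    rw [if_neg (by omega)]
    simp
  | zero => simp
  | add a b _ _ ha hb => rw [inner_add_left, ha, hb, add_zero]
  | smul c a _ ha => rw [inner_smul_left, ha, mul_zero]

theorem norm_coordInclusion_add {n k : ℕ} (hk : k ≤ n) (hkn : k ≤ n - 1) (hn : 1 ≤ n)
    (w : Euc k) (r : ℝ) :
    ‖coordInclusion hk w + r • lastVec n‖ = Real.sqrt (‖w‖ ^ 2 + r ^ 2) := by
  have h := norm_add_sq_eq_norm_sq_add_norm_sq_real
    (x := coordInclusion hk w) (y := r • lastVec n)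
    (by rw [inner_smul_right, inner_coordInclusion_lastVec hk hkn hn, mul_zero])
  rw [LinearIsometry.norm_map, norm_smul, norm_lastVec hn, mul_one] at h
  rw [eq_comm, Real.sqrt_eq_iff_mul_self_eq (by positivity) (norm_nonneg _), h]
  rw [Real.norm_eq_abs, abs_mul_abs_self]
  ring

/-- The Lebesgue integral over a subspace can be computed in any isometric parametrization. -/
theorem integral_submodule_eq {E F G : Type*} [NormedAddCommGroup E] [InnerProductSpace ℝ E]
    [FiniteDimensional ℝ E] [MeasurableSpace E] [BorelSpace E]
    [NormedAddCommGroup F] [InnerProductSpace ℝ F] [FiniteDimensional ℝ F]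
    [MeasurableSpace F] [BorelSpace F]
    [NormedAddCommGroup G] [NormedSpace ℝ G] (T : E →ₗᵢ[ℝ] F) {S : Submodule ℝ F}
    (hS : LinearMap.range T.toLinearMap = S) (g : F → G) :
    ∫ v : S, g v = ∫ w : E, g (T w) := by
  subst hS
  exact (T.equivRange.measurePreserving.integral_comp
    T.equivRange.toHomeomorph.measurableEmbedding (fun v => g v)).symm

/-- The `k`-plane transform may be computed from any base point `a` of the plane instead of its
foot, by translation invariance, and with `ℝᵏ` as parameter space. -/
theorem radon_rotatedPlane {n k : ℕ} (hk : k ≤ n) (f : Euc n → 𝕜) (γ : SO n) (a : Euc n) :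
    radon k f (rotatedPlane hk γ a) = ∫ w : Euc k, f (a + rot γ (coordInclusion hk w)) := by
  set τ := rotatedPlane hk γ a with hτ
  have ha : a ∈ τ.1 := AffineSubspace.self_mem_mk' _ _
  have hd : τ.1.direction = (coordSubspace n k).map (rot γ) := AffineSubspace.direction_mk' _ _
  have hfoot : τ.foot - a ∈ τ.1.direction := AffineSubspace.vsub_mem_direction τ.foot_mem ha
  let R : Euc n →ₗᵢ[ℝ] Euc n := ⟨rot γ, norm_rot γ⟩
  have hrange : LinearMap.range (R.comp (coordInclusion hk)).toLinearMap = τ.1.direction := by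
    rw [hd, ← range_coordInclusion hk]
    exact LinearMap.range_comp _ _
  have h1 := integral_submodule_eq (R.comp (coordInclusion hk)) hrange (fun z => f (a + z))
  have h2 := integral_add_left_eq_self (μ := (volume : Measure τ.1.direction))
    (fun v => f (a + (v : Euc n))) ⟨τ.foot - a, hfoot⟩
  simp only [Submodule.coe_add, add_sub_cancel, ← add_assoc] at h2
  exact h2.trans h1

/-! ### Calculus on the half-line -/

section
variable {E : Type*} [NormedAddCommGroup E] [NormedSpace ℝ E]

theorem contDiff_sum_pow_smul {ι : Type*} (s : Finset ι) (p : ι → ℕ) (c : ι → E) (N : ℕ) :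
    ContDiff ℝ N fun r : ℝ => ∑ j ∈ s, r ^ p j • c j := by
  fun_prop

theorem iteratedDeriv_sum_pow_smul_eq_zero {ι : Type*} {s : Finset ι} {p : ι → ℕ} (c : ι → E)
    {N : ℕ} (hp : ∀ j ∈ s, p j < N) (r : ℝ) :
    iteratedDeriv N (fun r : ℝ => ∑ j ∈ s, r ^ p j • c j) r = 0 := by
  rw [iteratedDeriv_fun_sum fun j _ => by fun_prop]
  refine Finset.sum_eq_zero fun j hj => ?_
  rw [iteratedDeriv_smul_const (by fun_prop), iteratedDeriv_pow,
    Nat.descFactorial_eq_zero_iff_lt.2 (hp j hj)]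
  simp

/-- In the Leibniz expansion of `∂^k (r^k P(r))` every term but the one with all derivatives on
`r^k` carries a positive power of `r`, so the `k`-th derivative is `k! P(0) + O(r)`, with a constant
that involves `P` only through bounds for its derivatives. -/
theorem norm_iteratedDeriv_pow_smul_sub_le {k : ℕ} (hk : 1 ≤ k) {P : ℝ → E} (hP : ContDiff ℝ k P)
    {B : ℕ → ℝ} (hB : ∀ i ≤ k, ∀ r, ‖iteratedDeriv i P r‖ ≤ B i) {r : ℝ} (hr : 0 < r)
    (hr1 : r ≤ 1) :
    ‖iteratedDeriv k (fun r => r ^ k • P r) r - (k.factorial : ℝ) • P 0‖ ≤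
      (∑ i ∈ Finset.range k, k.choose i * k.descFactorial i * B (k - i) +
        k.factorial * B 1) * r := by
  have hleib : iteratedDeriv k (fun r => r ^ k • P r) r = ∑ i ∈ Finset.range (k + 1),
      k.choose i • (k.descFactorial i * r ^ (k - i)) • iteratedDeriv (k - i) P r := by
    have h := iteratedDerivWithin_smul (Set.mem_univ r) uniqueDiffOn_univ
      (n := k) (f := fun r : ℝ => r ^ k) (g := P) (by fun_prop) hP.contDiffAt.contDiffWithinAt
    simp only [iteratedDerivWithin_univ, iteratedDeriv_pow] at h
    exact h
  have hB0 : ∀ i ≤ k, 0 ≤ B i := fun i hi => (norm_nonneg _).trans (hB i hi 0)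
  have hmvt : ‖P r - P 0‖ ≤ B 1 * r := by
    have h := Convex.norm_image_sub_le_of_norm_deriv_le (𝕜 := ℝ) (f := P) (s := Set.univ)
      (x := 0) (y := r) (C := B 1)
      (fun x _ => hP.differentiable (by exact_mod_cast (by omega : k ≠ 0)) x)
      (fun x _ => by simpa using hB 1 hk x)
      convex_univ (Set.mem_univ _) (Set.mem_univ _)
    simpa [abs_of_pos hr] using h
  rw [hleib, Finset.sum_range_succ]
  simp only [Nat.choose_self, Nat.descFactorial_self, Nat.sub_self, pow_zero, mul_one,
    iteratedDeriv_zero, one_smul]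
  rw [add_sub_assoc, ← smul_sub, add_mul, Finset.sum_mul]
  refine (norm_add_le _ _).trans (add_le_add ?_ ?_)
  · refine (norm_sum_le _ _).trans (Finset.sum_le_sum fun i hi => ?_)
    have hik : i < k := Finset.mem_range.1 hi
    rw [← Nat.cast_smul_eq_nsmul ℝ, smul_smul, norm_smul, Real.norm_of_nonneg (by positivity)]
    have h1 : r ^ (k - i) ≤ r := pow_le_of_le_one hr.le hr1 (by omega)
    -- `i < k`, so at least one factor `r ≤ 1` is left in this term
    have h2 := hB (k - i) (Nat.sub_le _ _) r
    calc _ ≤ (k.choose i * (k.descFactorial i * r) : ℝ) * B (k - i) := by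
          gcongr
      _ = _ := by ring
  · rw [norm_smul, Real.norm_of_nonneg (by positivity), mul_assoc]
    gcongr

end

theorem tendstoUniformly_nhdsGT_zero_of_norm_sub_le {X E : Type*} [NormedAddCommGroup E]
    {F : ℝ → X → E} {f : X → E} (K : ℝ)
    (h : ∀ r, 0 < r → r ≤ 1 → ∀ x, ‖F r x - f x‖ ≤ K * r) :
    TendstoUniformly F f (𝓝[>] (0 : ℝ)) := by
  rw [Metric.tendstoUniformly_iff]
  intro ε hε
  have ht : Tendsto (fun r : ℝ => K * r) (𝓝[>] 0) (𝓝 0) := by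
    have : Tendsto (fun r : ℝ => K * r) (𝓝 0) (𝓝 (K * 0)) := by
      apply Continuous.tendsto; fun_prop
    rw [mul_zero] at this
    exact this.mono_left nhdsWithin_le_nhds
  filter_upwards [ht.eventually_lt_const hε, Ioc_mem_nhdsGT one_pos] with r h1 h2 x
  rw [dist_comm, dist_eq_norm]
  exact (h r h2.1 h2.2 x).trans_lt h1

theorem integral_mul_sq_sub_one_pow (m : ℕ) :
    (∫ t in (0 : ℝ)..1, t * (t ^ 2 - 1) ^ m) = (-(-1) ^ (m + 1) / (2 * (m + 1)) : ℝ) := by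
  have hm : (m : ℝ) + 1 ≠ 0 := by positivity
  rw [intervalIntegral.integral_eq_sub_of_hasDerivAt
    (f := fun t : ℝ => (t ^ 2 - 1) ^ (m + 1) / (2 * (m + 1))) (fun t _ => ?_)
    ((by fun_prop : Continuous fun t : ℝ => t * (t ^ 2 - 1) ^ m).intervalIntegrable _ _)]
  · simp
    ring
  · have h := ((((hasDerivAt_id t).pow 2).sub_const 1).pow (m + 1)).div_const (2 * ((m : ℝ) + 1))
    refine h.congr_deriv ?_
    simp
    field_simp

/-- The area of the unit sphere is the dimension times the volume of the unit ball. -/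
theorem sphereArea_eq {k : ℕ} (hk : 1 ≤ k) :
    sphereArea (k - 1) = k * (volume : Measure (Euc k)).real (Metric.ball 0 1) := by
  have : Nonempty (Fin k) := ⟨⟨0, hk⟩⟩
  have hk0 : (0 : ℝ) < k := by exact_mod_cast hk
  have hG : 0 < Real.Gamma ((k : ℝ) / 2) := Real.Gamma_pos_of_pos (by positivity)
  rw [Measure.real, EuclideanSpace.volume_ball, sphereArea, Nat.cast_sub hk, Nat.cast_one,
    sub_add_cancel, Fintype.card_fin, ENNReal.ofReal_one, one_pow, one_mul,
    Real.Gamma_add_one (by positivity), ENNReal.toReal_ofReal (by positivity),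
    Real.sqrt_eq_rpow, ← Real.rpow_natCast, ← Real.rpow_mul Real.pi_nonneg]
  rw [show (1 / 2 : ℝ) * k = k / 2 by ring]
  field_simp

/-- Peetre's inequality for the weight `(1 + |·|)^{-μ}`, in terms of the norms involved. -/
theorem one_add_rpow_neg_le {μ a b c : ℝ} (hμ : 0 ≤ μ) (ha : 0 ≤ a) (hb : 0 ≤ b) (hc : 0 ≤ c)
    (h : c ≤ a + b) : (1 + b) ^ (-μ) ≤ (1 + a) ^ μ * (1 + c) ^ (-μ) := by
  rw [Real.rpow_neg (by positivity), Real.rpow_neg (by positivity), ← div_eq_mul_inv,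
    inv_eq_one_div, div_le_div_iff₀ (Real.rpow_pos_of_pos (by positivity) _)
    (Real.rpow_pos_of_pos (by positivity) _), one_mul, ← Real.mul_rpow (by positivity)
    (by positivity)]
  exact Real.rpow_le_rpow (by positivity) (by nlinarith [mul_nonneg ha hb]) hμ

/-- The substitution `s = √(y² + r²)`. -/
theorem setIntegral_Ioi_sqrt_comp {E : Type*} [NormedAddCommGroup E] [NormedSpace ℝ E]
    (m : ℕ) {r : ℝ} (hr : 0 < r) (g : ℝ → E) :
    ∫ y in Set.Ioi (0 : ℝ), y ^ (2 * m + 1) • g (Real.sqrt (y ^ 2 + r ^ 2)) =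
      ∫ s in Set.Ioi r, (s * (s ^ 2 - r ^ 2) ^ m) • g s := by
  have himg : (fun y : ℝ => Real.sqrt (y ^ 2 + r ^ 2)) '' Set.Ioi 0 = Set.Ioi r := by
    ext s
    constructor
    · rintro ⟨y, hy, rfl⟩
      have hy : 0 < y := hy
      exact Real.lt_sqrt_of_sq_lt (by nlinarith)
    · intro hs
      have hs : r < s := hs
      have h0 : 0 < s ^ 2 - r ^ 2 := by nlinarith
      refine ⟨Real.sqrt (s ^ 2 - r ^ 2), Real.sqrt_pos.2 h0, ?_⟩
      simp only
      rw [Real.sq_sqrt h0.le, sub_add_cancel, Real.sqrt_sq (hr.trans hs).le]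
  have hinj : Set.InjOn (fun y : ℝ => Real.sqrt (y ^ 2 + r ^ 2)) (Set.Ioi 0) := by
    intro a ha b hb hab
    have ha : 0 < a := ha
    have hb : 0 < b := hb
    have h := congrArg (· ^ 2) hab
    simp only [Real.sq_sqrt (by positivity : 0 ≤ a ^ 2 + r ^ 2),
      Real.sq_sqrt (by positivity : 0 ≤ b ^ 2 + r ^ 2)] at h
    exact (pow_left_inj₀ ha.le hb.le two_ne_zero).1 (by linarith)
  rw [← himg, integral_image_eq_integral_abs_deriv_smul measurableSet_Ioi
    (f' := fun y => y / Real.sqrt (y ^ 2 + r ^ 2)) (fun y _ => ?_) hinj]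
  · refine setIntegral_congr_fun measurableSet_Ioi fun y hy => ?_
    have hy : 0 < y := hy
    have hs : 0 < Real.sqrt (y ^ 2 + r ^ 2) := Real.sqrt_pos.2 (by positivity)
    rw [smul_smul, Real.sq_sqrt (by positivity), abs_of_pos (by positivity)]
    congr 1
    field_simp
    ring
  · have h := ((((hasDerivAt_id y).pow 2).add_const (r ^ 2)).sqrt
      (by simp; positivity)).hasDerivWithinAt (s := Set.Ioi 0)
    refine h.congr_deriv ?_
    simp
    field_simp

/-! ### Absolute convergence and reduction to spherical means -/

section
variable {n k : ℕ} {μ C : ℝ} {f : Euc n → 𝕜}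

theorem integrable_plane (hμ : (k : ℝ) < μ) (hf : Continuous f)
    (hC : ∀ x, ‖f x‖ ≤ C * (1 + ‖x‖) ^ (-μ)) (τ : AffinePlane n k) :
    Integrable fun v : τ.1.direction => f (τ.foot + (v : Euc n)) := by
  have hμ0 : 0 ≤ μ := k.cast_nonneg.trans hμ.le
  have hC0 : 0 ≤ C := by simpa using (norm_nonneg _).trans (hC 0)
  have hint : Integrable (fun v : τ.1.direction => (1 + ‖v‖) ^ (-μ)) :=
    integrable_one_add_norm (by rwa [τ.2.2])
  refine (hint.const_mul (C * (1 + ‖τ.foot‖) ^ μ)).mono'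
    (by fun_prop : Continuous _).aestronglyMeasurable (.of_forall fun v => ?_)
  refine (hC _).trans ?_
  rw [mul_assoc]
  refine mul_le_mul_of_nonneg_left ?_ hC0
  refine one_add_rpow_neg_le hμ0 (norm_nonneg _) (norm_nonneg _) (norm_nonneg _) ?_
  have h := norm_sub_le (τ.foot + (v : Euc n)) τ.foot
  rw [add_sub_cancel_left] at h
  rw [add_comm]
  exact h

/-- Decay of `f(x + γ y)` in `y`, uniform in the rotation `γ`. The parameter `c` is any lower bound
for `|y|`. -/
theorem norm_comp_add_rot_le (hμ : 0 ≤ μ)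
    (hC : ∀ x, ‖f x‖ ≤ C * (1 + ‖x‖) ^ (-μ)) (x y : Euc n) (γ : SO n) {c : ℝ} (hc0 : 0 ≤ c)
    (hc : c ≤ ‖y‖) :
    ‖f (x + rot γ y)‖ ≤ C * (1 + ‖x‖) ^ μ * (1 + c) ^ (-μ) := by
  have hC0 : 0 ≤ C := by simpa using (norm_nonneg _).trans (hC 0)
  refine (hC _).trans ?_
  rw [mul_assoc]
  refine mul_le_mul_of_nonneg_left ?_ hC0
  refine one_add_rpow_neg_le hμ (norm_nonneg _) (norm_nonneg _) hc0 (hc.trans ?_)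
  have h := norm_sub_le (x + rot γ y) x
  rw [add_sub_cancel_left, norm_rot] at h
  rw [add_comm]
  exact h

theorem integrable_prod_plane (hk : k ≤ n) (hkn : k ≤ n - 1) (hn : 1 ≤ n) (hμ : (k : ℝ) < μ)
    (hf : Continuous f) (hC : ∀ x, ‖f x‖ ≤ C * (1 + ‖x‖) ^ (-μ)) (x : Euc n) (r : ℝ) :
    Integrable (fun p : SO n × Euc k => f (x + rot p.1 (coordInclusion hk p.2 + r • lastVec n)))
      ((haarSO n).prod volume) := by
  have hμ0 : 0 ≤ μ := k.cast_nonneg.trans hμ.le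
  have hint : Integrable (fun w : Euc k => (1 + ‖w‖) ^ (-μ)) :=
    integrable_one_add_norm (by simpa using hμ)
  have hcont : Continuous fun p : SO n × Euc k =>
      f (x + rot p.1 (coordInclusion hk p.2 + r • lastVec n)) := by
    refine hf.comp (continuous_const.add (continuous_rot_apply.comp (continuous_fst.prodMk ?_)))
    exact ((coordInclusion hk).continuous.comp continuous_snd).add continuous_const
  refine ((hint.comp_snd (haarSO n)).const_mul (C * (1 + ‖x‖) ^ μ)).mono'
    hcont.aestronglyMeasurable (.of_forall fun p => ?_)
  refine norm_comp_add_rot_le hμ0 hC _ _ _ (norm_nonneg _) ?_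
  rw [norm_coordInclusion_add hk hkn hn]
  exact Real.le_sqrt_of_sq_le (by nlinarith [sq_nonneg r])

theorem radon_shiftedPlane (hk : k ≤ n) (f : Euc n → 𝕜) (x : Euc n) (r : ℝ) (γ : SO n) :
    radon k f (rotatedPlane hk γ (x + r • rot γ (lastVec n))) =
      ∫ w : Euc k, f (x + rot γ (coordInclusion hk w + r • lastVec n)) := by
  rw [radon_rotatedPlane]
  congr 1
  ext1 w
  rw [map_add, map_smul, add_assoc, add_comm (r • _)]

theorem integrable_radon_shiftedPlane (hk : k ≤ n) (hkn : k ≤ n - 1) (hn : 1 ≤ n)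
    (hμ : (k : ℝ) < μ)
    (hf : Continuous f) (hC : ∀ x, ‖f x‖ ≤ C * (1 + ‖x‖) ^ (-μ)) (x : Euc n) (r : ℝ) :
    Integrable (fun γ : SO n => radon k f (rotatedPlane hk γ (x + r • rot γ (lastVec n))))
      (haarSO n) := by
  simp only [radon_shiftedPlane]
  exact (integrable_prod_plane hk hkn hn hμ hf hC x r).integral_prod_left

/-- By Fubini the average over `SO(n)` may be taken first; since `γ v + r γ e_n` has length
`√(|v|² + r²)` for `v ∈ ℝᵏ`, it is a spherical mean of `f`. -/
theorem shiftedDual_radon_eq_integral_sphericalMean (hk : k ≤ n) (hkn : k ≤ n - 1) (hn : 2 ≤ n)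
    (hμ : (k : ℝ) < μ)
    (hf : Continuous f) (hC : ∀ x, ‖f x‖ ≤ C * (1 + ‖x‖) ^ (-μ)) (x : Euc n) (r : ℝ) :
    shiftedDual hk (radon k f) x r =
      ∫ w : Euc k, sphericalMean f x (Real.sqrt (‖w‖ ^ 2 + r ^ 2)) := by
  have hn1 := one_le_two.trans hn
  simp only [shiftedDual, radon_shiftedPlane]
  rw [integral_integral_swap (integrable_prod_plane hk hkn hn1 hμ hf hC x r)]
  simp only [integral_rot_eq_sphericalMean hn, norm_coordInclusion_add hk hkn hn1]

theorem continuous_sphericalMean (hf : Continuous f) {B : ℝ} (hB : ∀ x, ‖f x‖ ≤ B) (x : Euc n) :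
    Continuous (sphericalMean f x) := by
  have h : ∀ s : ℝ, Continuous fun γ : SO n => f (x + s • rot γ (lastVec n)) := fun s =>
    hf.comp (continuous_const.add ((continuous_rot_apply.comp
      (continuous_id.prodMk continuous_const)).const_smul s))
  exact continuous_of_dominated (bound := fun _ => B) (fun s => (h s).aestronglyMeasurable)
    (fun s => .of_forall fun γ => hB _) (integrable_const _) (.of_forall fun γ => by fun_prop)

theorem norm_sphericalMean_le (hn : 1 ≤ n) (hμ : 0 ≤ μ)
    (hC : ∀ x, ‖f x‖ ≤ C * (1 + ‖x‖) ^ (-μ)) (x : Euc n) {s : ℝ} (hs : 0 ≤ s) :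
    ‖sphericalMean f x s‖ ≤ C * (1 + ‖x‖) ^ μ * (1 + s) ^ (-μ) := by
  refine (norm_integral_le_of_norm_le_const (C := C * (1 + ‖x‖) ^ μ * (1 + s) ^ (-μ))
    (.of_forall fun γ => ?_)).trans_eq (by simp)
  rw [← map_smul]
  refine norm_comp_add_rot_le hμ hC x _ γ hs ?_
  rw [norm_smul, norm_lastVec hn, mul_one]
  exact le_abs_self s

theorem le_of_norm_le_one_add_norm_rpow (hμ : 0 ≤ μ)
    (hC : ∀ x, ‖f x‖ ≤ C * (1 + ‖x‖) ^ (-μ)) (x : Euc n) : ‖f x‖ ≤ C := by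
  have hC0 : 0 ≤ C := by simpa using (norm_nonneg _).trans (hC 0)
  exact (hC x).trans (mul_le_of_le_one_right hC0
    (Real.rpow_le_one_of_one_le_of_nonpos (by simp) (by simpa)))

theorem integrableOn_pow_smul_sphericalMean (hn : 1 ≤ n) (hμ : (k : ℝ) < μ)
    (hf : Continuous f) (hC : ∀ x, ‖f x‖ ≤ C * (1 + ‖x‖) ^ (-μ)) (x : Euc n) {p : ℕ} (hp : p < k) :
    IntegrableOn (fun s : ℝ => s ^ p • sphericalMean f x s) (Set.Ioi 0) := by
  have hμ0 : 0 ≤ μ := k.cast_nonneg.trans hμ.le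
  have hpk : (p : ℝ) + 1 ≤ k := by exact_mod_cast hp
  have hint : Integrable (fun s : ℝ => (1 + ‖s‖) ^ (-(μ - p))) :=
    integrable_one_add_norm (by simp; linarith)
  have hM := continuous_sphericalMean hf (le_of_norm_le_one_add_norm_rpow hμ0 hC) x
  refine ((hint.const_mul (C * (1 + ‖x‖) ^ μ)).integrableOn (s := Set.Ioi 0)).mono'
    (by fun_prop : Continuous fun s : ℝ => s ^ p • sphericalMean f x s).aestronglyMeasurable ?_
  filter_upwards [ae_restrict_mem measurableSet_Ioi] with s hs
  have hs : 0 < s := hs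
  have hsp : s ^ p ≤ (1 + s) ^ p := by gcongr; linarith
  rw [norm_smul, norm_pow, Real.norm_of_nonneg hs.le]
  calc s ^ p * ‖sphericalMean f x s‖
      ≤ (1 + s) ^ p * (C * (1 + ‖x‖) ^ μ * (1 + s) ^ (-μ)) := by
        gcongr
        exact norm_sphericalMean_le hn hμ0 hC x hs.le
    _ = C * (1 + ‖x‖) ^ μ * (1 + s) ^ (-(μ - p)) := by
        rw [neg_sub, sub_eq_add_neg, Real.rpow_add (by positivity), Real.rpow_natCast]
        ring

end

/-! ### The shifted dual transform as a polynomial plus a ball average -/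

section
variable {n m : ℕ} {μ C : ℝ} {f : Euc n → 𝕜}

/-- The integral `∫₀^∞ s (s² - r²)^m M(s) ds`, `M` being the spherical mean of `f` about `x`, expanded
by the binomial theorem: a polynomial in `r` of degree at most `2m` whose coefficients are moments
of `M`. -/
def momentPoly (f : Euc n → 𝕜) (m : ℕ) (x : Euc n) (r : ℝ) : 𝕜 :=
  ∑ j ∈ Finset.range (m + 1), r ^ (2 * (m - j)) •
    (((-1) ^ (m - j) * m.choose j : ℝ) •
      ∫ s in Set.Ioi (0 : ℝ), s ^ (2 * j + 1) • sphericalMean f x s)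

theorem kernel_smul_eq (m : ℕ) (r s : ℝ) (c : 𝕜) :
    (s * (s ^ 2 - r ^ 2) ^ m) • c = ∑ j ∈ Finset.range (m + 1), r ^ (2 * (m - j)) •
      (((-1) ^ (m - j) * m.choose j : ℝ) • (s ^ (2 * j + 1) • c)) := by
  simp only [smul_smul, ← Finset.sum_smul]
  congr 1
  rw [sub_eq_add_neg, add_pow, Finset.mul_sum]
  refine Finset.sum_congr rfl fun j _ => ?_
  rw [neg_pow, ← pow_mul, ← pow_mul]
  ring

theorem integrableOn_kernel (hn : 1 ≤ n) (hμ : ((2 * (m + 1) : ℕ) : ℝ) < μ)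
    (hf : Continuous f) (hC : ∀ x, ‖f x‖ ≤ C * (1 + ‖x‖) ^ (-μ)) (x : Euc n) (r : ℝ) :
    IntegrableOn (fun s : ℝ => (s * (s ^ 2 - r ^ 2) ^ m) • sphericalMean f x s) (Set.Ioi 0) := by
  simp only [kernel_smul_eq]
  refine integrable_finsetSum _ fun j hj => ?_
  have := Finset.mem_range.1 hj
  exact ((integrableOn_pow_smul_sphericalMean (p := 2 * j + 1) hn hμ hf hC x (by omega)).smul
      (_ : ℝ)).smul (_ : ℝ)

theorem integral_Ioi_zero_kernel (hn : 1 ≤ n) (hμ : ((2 * (m + 1) : ℕ) : ℝ) < μ)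
    (hf : Continuous f) (hC : ∀ x, ‖f x‖ ≤ C * (1 + ‖x‖) ^ (-μ)) (x : Euc n) (r : ℝ) :
    ∫ s in Set.Ioi (0 : ℝ), (s * (s ^ 2 - r ^ 2) ^ m) • sphericalMean f x s =
      momentPoly f m x r := by
  simp only [kernel_smul_eq]
  rw [integral_finsetSum, momentPoly]
  · simp only [integral_smul]
  · intro j hj
    have := Finset.mem_range.1 hj
    exact ((integrableOn_pow_smul_sphericalMean (p := 2 * j + 1) hn hμ hf hC x (by omega)).smul
      (_ : ℝ)).smul (_ : ℝ)

/-- The product of Lebesgue measure on `(0, 1]` with Haar measure on `SO(n)`: polar coordinates of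
the unit ball, without the Jacobian. -/
def ballMeasure (n : ℕ) : Measure (ℝ × SO n) :=
  (volume.restrict (Set.Ioc 0 1)).prod (haarSO n)

instance instIsProbabilityMeasureBallMeasure (n : ℕ) : IsProbabilityMeasure (ballMeasure n) := by
  have : IsProbabilityMeasure ((volume : Measure ℝ).restrict (Set.Ioc 0 1)) := ⟨by simp⟩
  unfold ballMeasure
  infer_instance

/-- The weight `t (t² - 1)^m` at the point with polar coordinates `(t, γ)`. -/
def ballWeight {n : ℕ} (m : ℕ) (p : ℝ × SO n) : ℝ := p.1 * (p.1 ^ 2 - 1) ^ m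

/-- The point `t γ e_n` of the unit ball with polar coordinates `(t, γ)`. -/
def ballVec {n : ℕ} (p : ℝ × SO n) : Euc n := p.1 • rot p.2 (lastVec n)

theorem continuous_ballWeight : Continuous (ballWeight (n := n) m) := by
  unfold ballWeight
  fun_prop

theorem continuous_ballVec : Continuous (ballVec (n := n)) :=
  continuous_fst.smul (continuous_rot_apply.comp (continuous_snd.prodMk continuous_const))

theorem ae_ballMeasure_fst_mem : ∀ᵐ p ∂(ballMeasure n), p.1 ∈ Set.Ioc (0 : ℝ) 1 :=
  Measure.quasiMeasurePreserving_fst.ae (ae_restrict_mem measurableSet_Ioc)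

theorem ae_abs_ballWeight_le : ∀ᵐ p ∂(ballMeasure n), |ballWeight m p| ≤ 1 := by
  filter_upwards [ae_ballMeasure_fst_mem] with p hp
  have h1 : |p.1| ≤ 1 := abs_le.2 ⟨by linarith [hp.1], hp.2⟩
  have h2 : |p.1 ^ 2 - 1| ≤ 1 := abs_le.2 ⟨by nlinarith [hp.1], by nlinarith [hp.1, hp.2]⟩
  rw [ballWeight, abs_mul, abs_pow]
  exact mul_le_one₀ h1 (by positivity) (pow_le_one₀ (abs_nonneg _) h2)

theorem ae_norm_ballVec_le (hn : 1 ≤ n) : ∀ᵐ p ∂(ballMeasure n), ‖ballVec p‖ ≤ 1 := by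
  filter_upwards [ae_ballMeasure_fst_mem] with p hp
  rw [ballVec, norm_smul, norm_rot, norm_lastVec hn, mul_one, Real.norm_of_nonneg hp.1.le]
  exact hp.2

/-- The average `∫₀¹ t (t² - 1)^m M(rt) dt` of the spherical means `M` of `f` about `x`. Written as a
single radial integral, its derivatives in `r` are controlled by those of `f`. -/
def ballMean (f : Euc n → 𝕜) (m : ℕ) (x : Euc n) (r : ℝ) : 𝕜 :=
  radialIntegral (ballMeasure n) (ballWeight m) ballVec f 0 x r

theorem ballMean_eq (hn : 1 ≤ n) (hf : Continuous f) {B : ℝ} (hB : ∀ x, ‖f x‖ ≤ B)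
    (x : Euc n) (r : ℝ) :
    ballMean f m x r = ∫ t in (0 : ℝ)..1, (t * (t ^ 2 - 1) ^ m) • sphericalMean f x (r * t) := by
  have hint := integrable_radialIntegrand (k := 0) (ν := ballMeasure n) (f := f)
    (contDiff_zero.2 hf) (continuous_ballWeight (m := m)) continuous_ballVec le_rfl
    (B := B) (by simpa using fun y _ _ => hB y) ae_abs_ballWeight_le (ae_norm_ballVec_le hn) x r
  rw [ballMean, radialIntegral, ballMeasure, integral_prod _ hint,
    intervalIntegral.integral_of_le zero_le_one]
  refine integral_congr_ae (.of_forall fun t => ?_)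
  simp only [ballWeight, ballVec, iteratedFDeriv_zero_apply, integral_smul, sphericalMean, smul_smul]

theorem ballMean_zero (hn : 1 ≤ n) (hf : Continuous f) {B : ℝ} (hB : ∀ x, ‖f x‖ ≤ B)
    (x : Euc n) :
    ballMean f m x 0 = (-(-1) ^ (m + 1) / (2 * (m + 1)) : ℝ) • f x := by
  rw [ballMean_eq hn hf hB, ← integral_mul_sq_sub_one_pow, ← intervalIntegral.integral_smul_const]
  simp [sphericalMean]

theorem integral_kernel_eq_pow_smul_ballMean (hn : 1 ≤ n) (hf : Continuous f) {B : ℝ}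
    (hB : ∀ x, ‖f x‖ ≤ B) (x : Euc n) (r : ℝ) :
    ∫ s in (0 : ℝ)..r, (s * (s ^ 2 - r ^ 2) ^ m) • sphericalMean f x s =
      r ^ (2 * (m + 1)) • ballMean f m x r := by
  have h := intervalIntegral.smul_integral_comp_mul_left (a := 0) (b := 1)
    (fun s : ℝ => (s * (s ^ 2 - r ^ 2) ^ m) • sphericalMean f x s) r
  rw [mul_zero, mul_one] at h
  rw [← h, ballMean_eq hn hf hB, ← intervalIntegral.integral_smul, ← intervalIntegral.integral_smul]
  refine intervalIntegral.integral_congr fun t _ => ?_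
  simp only [smul_smul]
  congr 1
  rw [show (r * t) ^ 2 - r ^ 2 = r ^ 2 * (t ^ 2 - 1) by ring, mul_pow, ← pow_mul]
  ring

/-- The integral `∫_r^∞ s (s² - r²)^m M(s) ds` splits as `∫₀^∞ - ∫₀^r`: the first part is a polynomial
in `r` of degree below `k = 2(m + 1)`, and in the second the substitution `s = rt` brings out the
factor `r^k`. -/
theorem shiftedDual_radon_eq (hk : 2 * (m + 1) ≤ n) (hkn : 2 * (m + 1) ≤ n - 1)
    (hμ : ((2 * (m + 1) : ℕ) : ℝ) < μ)
    (hf : Continuous f) (hC : ∀ x, ‖f x‖ ≤ C * (1 + ‖x‖) ^ (-μ)) (x : Euc n) {r : ℝ}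
    (hr : 0 < r) :
    shiftedDual hk (radon (2 * (m + 1)) f) x r = sphereArea (2 * (m + 1) - 1) •
      (momentPoly f m x r - r ^ (2 * (m + 1)) • ballMean f m x r) := by
  have hn : 2 ≤ n := by omega
  have hμ0 : 0 ≤ μ := (Nat.cast_nonneg _).trans hμ.le
  have hn1 := one_le_two.trans hn
  have hint := integrableOn_kernel hn1 hμ hf hC x r
  have : Nontrivial (Euc (2 * (m + 1))) :=
    Module.nontrivial_of_finrank_pos (R := ℝ) (by simp)
  rw [shiftedDual_radon_eq_integral_sphericalMean hk hkn hn hμ hf hC,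
    integral_fun_norm_addHaar volume (fun y => sphericalMean f x (Real.sqrt (y ^ 2 + r ^ 2))),
    finrank_euclideanSpace_fin, ← Nat.cast_smul_eq_nsmul ℝ, smul_smul,
    ← sphereArea_eq (by omega), show 2 * (m + 1) - 1 = 2 * m + 1 by omega,
    setIntegral_Ioi_sqrt_comp m hr,
    ← integral_kernel_eq_pow_smul_ballMean hn1 hf (le_of_norm_le_one_add_norm_rpow hμ0 hC),
    ← integral_Ioi_zero_kernel hn1 hμ hf hC,
    ← intervalIntegral.integral_Ioi_sub_Ioi hint hr.le, sub_sub_cancel]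

end

/-! ### The inversion formula -/

theorem inversionConst_mul_sphereArea (m : ℕ) :
    inversionConst (2 * (m + 1)) * sphereArea (2 * (m + 1) - 1) =
      (-1) ^ (m + 1) / (2 * (m + 1) - 1).factorial := by
  have h : sphereArea (2 * (m + 1) - 1) ≠ 0 := by
    have hG : 0 < Real.Gamma ((((2 * (m + 1) - 1 : ℕ) : ℝ) + 1) / 2) :=
      Real.Gamma_pos_of_pos (by positivity)
    unfold sphereArea
    positivity
  rw [inversionConst, Nat.mul_div_cancel_left _ two_pos]
  have hfac : ((2 * (m + 1) - 1).factorial : ℝ) ≠ 0 := by positivity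
  field_simp

/-- Smoothness of the shifted dual transform and the inversion formula, with `k = 2(m + 1)`. The
rate of convergence is `O(r)`, uniformly in `x`. -/
theorem contDiffOn_and_tendstoUniformly {n m : ℕ} {μ : ℝ} (hk : 2 * (m + 1) ≤ n)
    (hkn : 2 * (m + 1) ≤ n - 1)
    (hμ : ((2 * (m + 1) : ℕ) : ℝ) < μ) {f : Euc n → 𝕜} (hf : DecayClass n (2 * (m + 1)) μ f) :
    (∀ x : Euc n, ContDiffOn ℝ (2 * (m + 1) : ℕ)
      (shiftedDual hk (radon (2 * (m + 1)) f) x) (Set.Ioi 0)) ∧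
    TendstoUniformly
      (fun (r : ℝ) (x : Euc n) => inversionConst (2 * (m + 1)) • ((-1 : ℝ) ^ (2 * (m + 1)) •
          iteratedDeriv (2 * (m + 1)) (shiftedDual hk (radon (2 * (m + 1)) f) x) r))
      f (𝓝[>] (0 : ℝ)) := by
  set k := 2 * (m + 1) with hkdef
  have hn1 : 1 ≤ n := by omega
  have hk1 : 1 ≤ k := by omega
  have hμ0 : 0 ≤ μ := k.cast_nonneg.trans hμ.le
  have hfc := hf.1.continuous
  obtain ⟨C, -, hC⟩ := hf.exists_norm_le hμ0
  have hfC := le_of_norm_le_one_add_norm_rpow hμ0 hC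
  have hB : ∀ i ≤ k, ∃ B, ∀ y u, ‖u‖ ≤ 1 → ‖iteratedFDeriv ℝ i f y (fun _ => u)‖ ≤ B :=
    fun i hi => hf.exists_norm_iteratedFDeriv_le hμ0 hi
  have hP : ∀ x, ContDiff ℝ k (ballMean f m x) := fun x =>
    contDiff_radialIntegral hf.1 continuous_ballWeight continuous_ballVec hB ae_abs_ballWeight_le
      (ae_norm_ballVec_le hn1) x
  have hQ : ∀ x, ContDiff ℝ k (momentPoly f m x) := fun x => contDiff_sum_pow_smul _ _ _ _
  have hrP : ∀ x, ContDiff ℝ k fun r : ℝ => r ^ k • ballMean f m x r := fun x =>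
    (contDiff_id.pow k).smul (hP x)
  have heq : ∀ x, Set.EqOn (shiftedDual hk (radon k f) x)
      (fun r => sphereArea (k - 1) • (momentPoly f m x r - r ^ k • ballMean f m x r))
      (Set.Ioi 0) := fun x r hr => shiftedDual_radon_eq hk hkn hμ hfc hC x hr
  refine ⟨fun x => ?_, ?_⟩
  · exact ContDiffOn.congr (((hQ x).sub (hrP x)).const_smul _).contDiffOn (heq x)
  choose! B hB' using hB
  refine tendstoUniformly_nhdsGT_zero_of_norm_sub_le
    (‖inversionConst k * sphereArea (k - 1)‖ *
      (∑ i ∈ Finset.range k, k.choose i * k.descFactorial i * B (k - i) + k.factorial * B 1))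
    fun r hr hr1 x => ?_
  have hbound := norm_iteratedDeriv_pow_smul_sub_le hk1 (hP x) (B := B) (fun i hi s => by
    unfold ballMean
    rw [iteratedDeriv_radialIntegral hf.1 continuous_ballWeight continuous_ballVec
      (fun i hi => ⟨B i, hB' i hi⟩) ae_abs_ballWeight_le (ae_norm_ballVec_le hn1) hi]
    simpa using norm_radialIntegral_le (ν := ballMeasure n) (hB' i hi) ae_abs_ballWeight_le
      (ae_norm_ballVec_le hn1) x s) hr hr1
  have hderiv : iteratedDeriv k (shiftedDual hk (radon k f) x) r =
      -(sphereArea (k - 1) • iteratedDeriv k (fun r => r ^ k • ballMean f m x r) r) := by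
    rw [(heq x).iteratedDeriv_of_isOpen isOpen_Ioi k hr, iteratedDeriv_fun_const_smul_field,
      iteratedDeriv_fun_sub (hQ x).contDiffAt (hrP x).contDiffAt]
    unfold momentPoly
    rw [iteratedDeriv_sum_pow_smul_eq_zero _ fun j _ => by omega, zero_sub, smul_neg]
  -- the constant `c_k` is the one that turns `-k! σ_{k-1} P(0)` into `f(x)`
  have hf0 : f x = -((inversionConst k * sphereArea (k - 1)) •
      ((k.factorial : ℝ) • ballMean f m x 0)) := by
    rw [ballMean_zero hn1 hfc hfC, inversionConst_mul_sphereArea, smul_smul, smul_smul, ← neg_smul]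
    have hfac : (k.factorial : ℝ) = (2 * (m + 1)) * (k - 1).factorial := by
      rw [← Nat.mul_factorial_pred (by omega : k ≠ 0), hkdef]
      push_cast
      ring
    have hne : ((k - 1).factorial : ℝ) ≠ 0 := by positivity
    have hsq : ((-1 : ℝ) ^ (m + 1)) * (-1) ^ (m + 1) = 1 := by
      rw [← mul_pow]; simp
    rw [hfac]
    have hone : -((-1 : ℝ) ^ (m + 1) / (k - 1).factorial * ((2 * (m + 1)) * (k - 1).factorial) *
        (-(-1) ^ (m + 1) / (2 * (m + 1)))) = 1 := by
      field_simp
      linear_combination hsq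
    rw [hone, one_smul]
  have heven : (-1 : ℝ) ^ k = 1 := by rw [hkdef, pow_mul]; simp
  rw [hderiv, heven, one_smul]
  calc _ = ‖-((inversionConst k * sphereArea (k - 1)) •
        (iteratedDeriv k (fun r => r ^ k • ballMean f m x r) r -
          (k.factorial : ℝ) • ballMean f m x 0))‖ := by
        conv_lhs => rw [hf0]
        rw [smul_neg, smul_smul, smul_sub, neg_sub, sub_neg_eq_add, neg_add_eq_sub]
    _ ≤ _ := by
        rw [norm_neg, norm_smul, mul_assoc]
        gcongr

end KPlane

end


theorem mainTheorem8 {𝕜 : Type*} [RCLike 𝕜] (n k : ℕ) (hk : 1 ≤ k) (hkn : k ≤ n - 1)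
    (hkeven : Even k) (μ : ℝ) (hμ : (k : ℝ) < μ) (f : KPlane.Euc n → 𝕜)
    (hf : KPlane.DecayClass n k μ f) :
    (∀ τ : KPlane.AffinePlane n k,
      Integrable fun v : τ.1.direction => f (τ.foot + (v : KPlane.Euc n))) ∧
    (∀ (x : KPlane.Euc n) (r : ℝ), 0 < r →
      Integrable (fun γ : KPlane.SO n => KPlane.radon k f
        (KPlane.rotatedPlane (hkn.trans (Nat.sub_le n 1)) γ
          (x + r • KPlane.rot γ (KPlane.lastVec n))))
        (KPlane.haarSO n)) ∧
    (∀ x : KPlane.Euc n,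
      ContDiffOn ℝ k (KPlane.shiftedDual (hkn.trans (Nat.sub_le n 1)) (KPlane.radon k f) x)
        (Set.Ioi 0)) ∧
    TendstoUniformly
      (fun (r : ℝ) (x : KPlane.Euc n) =>
        KPlane.inversionConst k • ((-1 : ℝ) ^ k •
          iteratedDeriv k
            (KPlane.shiftedDual (hkn.trans (Nat.sub_le n 1)) (KPlane.radon k f) x) r))
      f (𝓝[>] (0 : ℝ)) := by
  obtain ⟨C, -, hC⟩ := hf.exists_norm_le (k.cast_nonneg.trans hμ.le)
  obtain ⟨m, rfl⟩ : ∃ m, k = 2 * (m + 1) := by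
    obtain ⟨j, rfl⟩ := hkeven
    exact ⟨j - 1, by omega⟩
  exact ⟨KPlane.integrable_plane hμ hf.1.continuous hC,
    fun x r _ => KPlane.integrable_radon_shiftedPlane _ hkn (by omega) hμ hf.1.continuous hC x r,
    KPlane.contDiffOn_and_tendstoUniformly _ hkn hμ hf⟩
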